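/- **Theorem.** Let $k$ be a field and let $A$ be a finite-dimensional (associative, unital) $k$-algebra. Let $A\text{-mod}$ be the abelian category of finite-dimensional left $A$-modules, and let $D^b(A\text{-mod})$ be its bounded derived category. Then $D^b(A\text{-mod})$ is a Krull–Schmidt category: every object $X$ of $D^b(A\text{-mod})$ has a finite direct sum decomposition $X\cong X_1\oplus\cdots\oplus X_n$ (with $n\ge 0$; $n=0$ for $X=0$) in which each $X_i$ is indecomposable and has a local endomorphism ring. -/

import Mathlib

open CategoryTheory CategoryTheory.Limits

/-- An additive category is Krull-Schmidt if every object is isomorphic to a finite direct sum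
(possibly empty, for the zero object) of indecomposable objects with local endomorphism rings. -/
class IsKrullSchmidt (C : Type*) [Category C] [Preadditive C] [HasFiniteBiproducts C] : Prop where
  exists_decomposition : ∀ X : C, ∃ (n : ℕ) (Y : Fin n → C),
    haveI := hasBinaryBiproducts_of_finite_biproducts C
    Nonempty (X ≅ ⨁ Y) ∧ ∀ i, Indecomposable (Y i) ∧ IsLocalRing (End (Y i))

/-- For a finite-dimensional `k`-algebra `A`, finitely generated `A`-modules are the same as
finite-dimensional ones, so `FGModuleCat A` is the category of finite-dimensional modules. -/
theorem finite_iff_finiteDimensional (k A M : Type*) [Field k] [Ring A] [Algebra k A]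
    [FiniteDimensional k A] [AddCommGroup M] [Module k M] [Module A M] [IsScalarTower k A M] :
    Module.Finite A M ↔ FiniteDimensional k M :=
  ⟨fun _ => Module.Finite.trans A M, fun _ => Module.Finite.of_restrictScalars_finite k A M⟩

universe u v w

/-! All idempotent splitting happens in the abelian category of complexes. A bounded object is
`Q.obj K` with `K` a strictly bounded complex of finite-dimensional modules such that `End K` maps
onto `End (Q.obj K)` (`exists_iso_Q_obj_map_surjective`). As `End K` is finite-dimensional,
splitting idempotents of `K` stops by induction on dimension; then each piece has a local
endomorphism ring, or zero image under `Q`, and a nonzero quotient of a local ring is local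
(`nonempty_localDecomposition_map`). To find `K`, take a bounded above projective model, whose
derived endomorphisms lift to chain maps, and truncate it below. -/

section Algebra

/-! ### Local rings and idempotents -/

/-- In a finite-dimensional algebra without nontrivial idempotents, every element is either
invertible or nilpotent. -/
theorem isUnit_or_isNilpotent_of_finiteDimensional (k : Type*) {R : Type*} [Field k] [Ring R]
    [Algebra k R] [FiniteDimensional k R]
    (h : ∀ e : R, IsIdempotentElem e → e = 0 ∨ e = 1) (f : R) : IsUnit f ∨ IsNilpotent f := by
  obtain ⟨q, hq, hq'⟩ := Polynomial.exists_eq_pow_rootMultiplicity_mul_and_not_dvd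
    (minpoly k f) (minpoly.ne_zero (Algebra.IsIntegral.isIntegral f)) 0
  set n := (minpoly k f).rootMultiplicity 0
  simp only [map_zero, sub_zero] at hq hq'
  -- Bézout yields the Fitting idempotent. The exponent is `n + 1` because `n` may be `0`, and a
  -- factor `X` is needed to read off the inverse of `f`.
  obtain ⟨a, b, hab⟩ : IsCoprime ((Polynomial.X : Polynomial k) ^ (n + 1)) q :=
    IsCoprime.pow_left ((Polynomial.irreducible_X.coprime_iff_not_dvd).2 hq')
  have hz : Polynomial.aeval f (Polynomial.X ^ (n + 1) * q) = 0 := by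
    rw [pow_succ', mul_assoc, ← hq, map_mul, minpoly.aeval, mul_zero]
  have hsum : Polynomial.aeval f (a * Polynomial.X ^ (n + 1)) + Polynomial.aeval f (b * q) = 1 := by
    rw [← map_add, hab, map_one]
  have hprod :
      Polynomial.aeval f (a * Polynomial.X ^ (n + 1)) * Polynomial.aeval f (b * q) = 0 := by
    rw [← map_mul, mul_mul_mul_comm, map_mul, hz, mul_zero]
  have hid : IsIdempotentElem (Polynomial.aeval f (a * Polynomial.X ^ (n + 1))) := by
    have := congrArg (Polynomial.aeval f (a * Polynomial.X ^ (n + 1)) * ·) hsum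
    simp only [mul_add, hprod, add_zero, mul_one] at this
    exact this
  rcases h _ hid with h0 | h1
  · right
    rw [h0, zero_add] at hsum
    refine ⟨n + 1, ?_⟩
    calc f ^ (n + 1) = Polynomial.aeval f (Polynomial.X ^ (n + 1)) *
          Polynomial.aeval f (b * q) := by rw [hsum]; simp
      _ = 0 := by rw [← map_mul, mul_left_comm, map_mul, hz, mul_zero]
  · left
    refine isUnit_iff_exists.2 ⟨Polynomial.aeval f (a * Polynomial.X ^ n), ?_, ?_⟩
    · calc f * Polynomial.aeval f (a * Polynomial.X ^ n)
          = Polynomial.aeval f (Polynomial.X * (a * Polynomial.X ^ n)) := by simp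
        _ = 1 := (congrArg _ (by ring)).trans h1
    · calc Polynomial.aeval f (a * Polynomial.X ^ n) * f
          = Polynomial.aeval f (a * Polynomial.X ^ n * Polynomial.X) := by simp
        _ = 1 := (congrArg _ (by ring)).trans h1

/-- A finite-dimensional nontrivial algebra without nontrivial idempotents is local. -/
theorem isLocalRing_of_finiteDimensional (k : Type*) {R : Type*} [Field k] [Ring R]
    [Algebra k R] [FiniteDimensional k R] [Nontrivial R]
    (h : ∀ e : R, IsIdempotentElem e → e = 0 ∨ e = 1) : IsLocalRing R where
  isUnit_or_isUnit_of_add_one {a b} hab := by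
    obtain rfl : b = 1 - a := by rw [← hab]; abel
    exact (isUnit_or_isNilpotent_of_finiteDimensional k h a).imp id fun h ↦ h.isUnit_one_sub

/-- A nontrivial quotient of a (possibly noncommutative) local ring is local. -/
theorem IsLocalRing.of_ringHom_surjective {R S : Type*} [Ring R] [IsLocalRing R] [Ring S]
    [Nontrivial S] (f : R →+* S) (hf : Function.Surjective f) : IsLocalRing S where
  isUnit_or_isUnit_of_add_one {a b} hab := by
    obtain ⟨a, rfl⟩ := hf a
    obtain rfl : b = f (1 - a) := by rw [map_sub, map_one, ← hab]; abel
    exact (IsLocalRing.isUnit_or_isUnit_of_add_one (add_sub_cancel a 1)).imp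
      (fun h ↦ h.map f) (fun h ↦ h.map f)

/-- The only idempotents of a local ring are `0` and `1`. -/
theorem IsLocalRing.eq_zero_or_one_of_isIdempotentElem {R : Type*} [Ring R] [IsLocalRing R]
    {e : R} (he : IsIdempotentElem e) : e = 0 ∨ e = 1 := by
  rcases IsLocalRing.isUnit_or_isUnit_of_add_one (add_sub_cancel e 1) with h | h
  · right
    exact (h.mul_left_cancel (he.trans (mul_one e).symm))
  · left
    have := (h.mul_left_cancel (he.one_sub.trans (mul_one (1 - e)).symm))
    simpa using this

end Algebra

/-! ### Decompositions into objects with local endomorphism rings -/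

namespace CategoryTheory

/-- A finite family of objects with local endomorphism rings, exhibiting `X` as their direct sum
through the inclusions and projections. -/
structure LocalDecomposition {C : Type*} [Category C] [Preadditive C] (X : C) where
  /-- the index type -/
  J : Type
  [fintype : Fintype J]
  /-- the summands -/
  obj : J → C
  /-- the inclusions -/
  ι : ∀ j, obj j ⟶ X
  /-- the projections -/
  π : ∀ j, X ⟶ obj j
  ι_π_self : ∀ j, ι j ≫ π j = 𝟙 _
  ι_π_ne : ∀ i j, i ≠ j → ι i ≫ π j = 0
  total : ∑ j, π j ≫ ι j = 𝟙 X
  isLocalRing : ∀ j, IsLocalRing (End (obj j))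

attribute [instance] LocalDecomposition.fintype

namespace LocalDecomposition

variable {C : Type*} [Category C] [Preadditive C]

/-- The empty decomposition of a zero object. -/
def ofIsZero {X : C} (h : IsZero X) : LocalDecomposition X where
  J := Empty
  obj := Empty.elim
  ι j := j.elim
  π j := j.elim
  ι_π_self j := j.elim
  ι_π_ne j := j.elim
  total := h.eq_of_src _ _
  isLocalRing j := j.elim

/-- The decomposition with one summand. -/
def single (X : C) [h : IsLocalRing (End X)] : LocalDecomposition X where
  J := Unit
  obj _ := X
  ι _ := 𝟙 X
  π _ := 𝟙 X
  ι_π_self _ := by simp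
  ι_π_ne i j h := (h rfl).elim
  total := by simp
  isLocalRing _ := h

/-- The decomposition obtained from decompositions of two complementary summands. -/
def sum {X Y Z : C} (i : Y ⟶ X) (p : X ⟶ Y) (i' : Z ⟶ X) (p' : X ⟶ Z)
    (h₁ : i ≫ p = 𝟙 Y) (h₂ : i' ≫ p' = 𝟙 Z) (h₃ : i ≫ p' = 0) (h₄ : i' ≫ p = 0)
    (h₅ : p ≫ i + p' ≫ i' = 𝟙 X) (dY : LocalDecomposition Y) (dZ : LocalDecomposition Z) :
    LocalDecomposition X where
  J := dY.J ⊕ dZ.J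
  obj := Sum.elim dY.obj dZ.obj
  ι := Sum.rec (fun j ↦ dY.ι j ≫ i) (fun j ↦ dZ.ι j ≫ i')
  π := Sum.rec (fun j ↦ p ≫ dY.π j) (fun j ↦ p' ≫ dZ.π j)
  ι_π_self := by
    rintro (j | j)
    · simp [reassoc_of% h₁, dY.ι_π_self]
    · simp [reassoc_of% h₂, dZ.ι_π_self]
  ι_π_ne := by
    rintro (a | a) (b | b) hab
    · change (dY.ι a ≫ i) ≫ p ≫ dY.π b = 0
      rw [Category.assoc, reassoc_of% h₁, dY.ι_π_ne a b (by simpa using hab)]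
    · change (dY.ι a ≫ i) ≫ p' ≫ dZ.π b = 0
      rw [Category.assoc, reassoc_of% h₃, zero_comp, comp_zero]
    · change (dZ.ι a ≫ i') ≫ p ≫ dY.π b = 0
      rw [Category.assoc, reassoc_of% h₄, zero_comp, comp_zero]
    · change (dZ.ι a ≫ i') ≫ p' ≫ dZ.π b = 0
      rw [Category.assoc, reassoc_of% h₂, dZ.ι_π_ne a b (by simpa using hab)]
  total := by
    have hY : ∑ j, p ≫ (dY.π j ≫ dY.ι j) ≫ i = p ≫ i := by
      rw [← Preadditive.comp_sum, ← Preadditive.sum_comp, dY.total, Category.id_comp]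
    have hZ : ∑ j, p' ≫ (dZ.π j ≫ dZ.ι j) ≫ i' = p' ≫ i' := by
      rw [← Preadditive.comp_sum, ← Preadditive.sum_comp, dZ.total, Category.id_comp]
    simp only [Category.assoc] at hY hZ
    simp [hY, hZ, h₅]
  isLocalRing := by
    rintro (j | j)
    · exact dY.isLocalRing j
    · exact dZ.isLocalRing j

/-- Transport of a decomposition along an isomorphism. -/
def ofIso {X Y : C} (e : X ≅ Y) (d : LocalDecomposition X) : LocalDecomposition Y where
  J := d.J
  obj := d.obj
  ι j := d.ι j ≫ e.hom
  π j := e.inv ≫ d.π j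
  ι_π_self j := by simp [d.ι_π_self]
  ι_π_ne i j h := by simp [d.ι_π_ne i j h]
  total := by
    have : ∑ j, e.inv ≫ (d.π j ≫ d.ι j) ≫ e.hom = 𝟙 Y := by
      rw [← Preadditive.comp_sum, ← Preadditive.sum_comp, d.total, Category.id_comp, e.inv_hom_id]
    simpa using this
  isLocalRing := d.isLocalRing

/-- Each summand is a retract. -/
def retract {X : C} (d : LocalDecomposition X) (j : d.J) : Retract (d.obj j) X where
  i := d.ι j
  r := d.π j
  retract := d.ι_π_self j

/-- A decomposition of an object of a full subcategory whose summands lie in the subcategory. -/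
def lift (P : ObjectProperty C) (X : P.FullSubcategory) (d : LocalDecomposition X.obj)
    (h : ∀ j, P (d.obj j)) : LocalDecomposition X where
  J := d.J
  obj j := ⟨d.obj j, h j⟩
  ι j := ObjectProperty.homMk (d.ι j)
  π j := ObjectProperty.homMk (d.π j)
  ι_π_self j := by ext; simpa using d.ι_π_self j
  ι_π_ne i j h := by ext; simpa using d.ι_π_ne i j h
  total := P.ι.map_injective (by
    rw [Functor.map_sum]
    simpa using d.total)
  isLocalRing j := by
    have := d.isLocalRing j
    let e : End (⟨d.obj j, h j⟩ : P.FullSubcategory) ≃* End (d.obj j) :=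
      P.fullyFaithfulι.mulEquivEnd _
    let e' : End (⟨d.obj j, h j⟩ : P.FullSubcategory) ≃+* End (d.obj j) :=
      { e with map_add' := fun _ _ ↦ rfl }
    have : Nontrivial (End (⟨d.obj j, h j⟩ : P.FullSubcategory)) := e'.nontrivial
    exact IsLocalRing.of_ringHom_surjective e'.symm.toRingHom e'.symm.surjective

/-- The object is the biproduct of the summands. -/
theorem exists_iso_biproduct [HasFiniteBiproducts C] {X : C} (d : LocalDecomposition X) :
    ∃ (n : ℕ) (Y : Fin n → C), Nonempty (X ≅ ⨁ Y) ∧ ∀ i, IsLocalRing (End (Y i)) := by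
  classical
  let ε := (Fintype.equivFin d.J).symm
  refine ⟨Fintype.card d.J, fun i ↦ d.obj (ε i), ⟨?_⟩, fun i ↦ d.isLocalRing _⟩
  let b : Limits.Bicone (fun i ↦ d.obj (ε i)) :=
    { pt := X
      π := fun i ↦ d.π (ε i)
      ι := fun i ↦ d.ι (ε i)
      ι_π := fun i j ↦ by
        split_ifs with h
        · subst h
          simpa using d.ι_π_self _
        · exact d.ι_π_ne _ _ fun h' ↦ h (ε.injective h') }
  have hb : b.IsBilimit := isBilimitOfTotal b (by
    rw [← d.total]
    exact Equiv.sum_comp ε fun j ↦ d.π j ≫ d.ι j)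
  exact biproduct.uniqueUpToIso _ hb

end LocalDecomposition

/-- An object with local endomorphism ring is indecomposable. -/
theorem indecomposable_of_isLocalRing_end {C : Type*} [Category C] [Preadditive C]
    [HasBinaryBiproducts C] (X : C) [IsLocalRing (End X)] : Indecomposable X := by
  refine ⟨fun h ↦ one_ne_zero (α := End X) (h.eq_of_src _ _), fun Y Z e ↦ ?_⟩
  let a : End X := e.hom ≫ biprod.fst ≫ biprod.inl ≫ e.inv
  have ha : IsIdempotentElem a := by
    change (e.hom ≫ biprod.fst ≫ biprod.inl ≫ e.inv) ≫
      (e.hom ≫ biprod.fst ≫ biprod.inl ≫ e.inv) = e.hom ≫ biprod.fst ≫ biprod.inl ≫ e.inv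
    simp
  rcases IsLocalRing.eq_zero_or_one_of_isIdempotentElem ha with h | h
  · left
    have : biprod.inl ≫ e.inv ≫ a ≫ e.hom ≫ biprod.fst = 𝟙 Y := by simp [a]
    rw [h] at this
    rw [IsZero.iff_id_eq_zero, ← this]
    change _ ≫ _ ≫ (0 : X ⟶ X) ≫ _ = 0
    simp
  · right
    have : biprod.inr ≫ e.inv ≫ a ≫ e.hom ≫ biprod.snd = 0 := by simp [a]
    rw [h] at this
    rw [IsZero.iff_id_eq_zero, ← this]
    change _ = _ ≫ _ ≫ 𝟙 X ≫ _
    simp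

/-! ### Splitting by induction on the dimension of the endomorphism algebra -/

section

variable (k : Type*) [Field k] {C : Type*} [Category C] [Preadditive C] [Linear k C]

/-- The endomorphism algebra of a retract is smaller if the complement is nonzero. -/
theorem finrank_end_lt_of_retract {X Y : C} [FiniteDimensional k (X ⟶ X)]
    (i : Y ⟶ X) (p : X ⟶ Y) (h : i ≫ p = 𝟙 Y) (hne : p ≫ i ≠ 𝟙 X) :
    FiniteDimensional k (Y ⟶ Y) ∧
      Module.finrank k (Y ⟶ Y) < Module.finrank k (X ⟶ X) := by
  let φ : (Y ⟶ Y) →ₗ[k] (X ⟶ X) := (Linear.leftComp k X p).comp (Linear.rightComp k Y i)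
  have hφ (f : Y ⟶ Y) : φ f = p ≫ f ≫ i := rfl
  have inj : Function.Injective φ := fun f g hfg ↦ by
    have := congrArg (fun t ↦ i ≫ t ≫ p) hfg
    simpa [hφ, reassoc_of% h, h] using this
  refine ⟨Module.Finite.of_injective φ inj, ?_⟩
  rw [← LinearMap.finrank_range_of_inj inj]
  -- Every `p ≫ f ≫ i` is fixed by the idempotent `p ≫ i`, so `𝟙 X` in the range would force `p ≫ i
  -- = 𝟙 X`.
  refine Submodule.finrank_lt fun htop ↦ hne ?_
  obtain ⟨f, hf⟩ : 𝟙 X ∈ LinearMap.range φ := htop ▸ Submodule.mem_top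
  rw [hφ] at hf
  calc p ≫ i = p ≫ i ≫ p ≫ f ≫ i := by rw [hf, Category.comp_id]
    _ = 𝟙 X := by rw [reassoc_of% h, hf]

/-- If `X` has a finite-dimensional endomorphism algebra in an idempotent complete category and
`F` is surjective on endomorphisms of `X`, then `F.obj X` is a finite direct sum of objects with
local endomorphism rings. -/
theorem nonempty_localDecomposition_map [IsIdempotentComplete C] {D : Type*} [Category D]
    [Preadditive D] (F : C ⥤ D) [F.Additive] (X : C) [FiniteDimensional k (X ⟶ X)]
    (hF : Function.Surjective (F.map : (X ⟶ X) → _)) :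
    Nonempty (LocalDecomposition (F.obj X)) := by
  obtain ⟨n, hn⟩ : ∃ n, Module.finrank k (X ⟶ X) = n := ⟨_, rfl⟩
  induction n using Nat.strong_induction_on generalizing X with
  | _ n ih =>
  -- `F` may kill a nonzero `X`, such as an acyclic complex under `Q`.
  by_cases hz : IsZero (F.obj X)
  · exact ⟨.ofIsZero hz⟩
  have hnt : Nontrivial (End (F.obj X)) := ⟨𝟙 _, 0, fun h ↦ hz ((IsZero.iff_id_eq_zero _).2 h)⟩
  by_cases hid : ∀ e : End X, IsIdempotentElem e → e = 0 ∨ e = 1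
  · let φ : End X →+* End (F.obj X) :=
      { F.mapEnd X with
        map_zero' := F.map_zero _ _
        map_add' := fun _ _ ↦ F.map_add }
    have : FiniteDimensional k (End X) := ‹FiniteDimensional k (X ⟶ X)›
    have : Nontrivial (End X) := φ.domain_nontrivial
    have := isLocalRing_of_finiteDimensional k hid
    have := IsLocalRing.of_ringHom_surjective φ hF
    exact ⟨.single _⟩
  · push Not at hid
    obtain ⟨e, he, he0, he1⟩ := hid
    change X ⟶ X at e
    replace he : e ≫ e = e := he
    obtain ⟨Y, i, p, hip, hpi⟩ := IsIdempotentComplete.idempotents_split X e he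
    obtain ⟨Z, i', p', hip', hpi'⟩ :=
      IsIdempotentComplete.idempotents_split X (𝟙 X - e) (by simp [he])
    have hep' : e ≫ p' = 0 := by
      have : e ≫ (p' ≫ i') ≫ p' = 0 := by
        rw [hpi', ← Category.assoc]; simp [he]
      simpa [hip'] using this
    have hi'e : i' ≫ e = 0 := by
      have : i' ≫ (p' ≫ i') ≫ e = 0 := by rw [hpi']; simp [he]
      simpa [reassoc_of% hip'] using this
    have h₃ : i ≫ p' = 0 := by
      rw [← hpi] at hep'
      have := congrArg (i ≫ ·) hep'
      simpa [reassoc_of% hip] using this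
    have h₄ : i' ≫ p = 0 := by
      rw [← hpi] at hi'e
      have := congrArg (· ≫ p) hi'e
      simpa [hip] using this
    have hsum : p ≫ i + p' ≫ i' = 𝟙 X := by rw [hpi, hpi']; abel
    -- Surjectivity passes to retracts: extend `g` to `F.obj X`, lift it there, and compress the
    -- lift to `W`.
    have surj {W : C} (a : W ⟶ X) (b : X ⟶ W) (hab : a ≫ b = 𝟙 W) :
        Function.Surjective (F.map : (W ⟶ W) → _) := fun g ↦ by
      obtain ⟨f, hf⟩ := hF (F.map b ≫ g ≫ F.map a)
      refine ⟨a ≫ f ≫ b, ?_⟩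
      have hab' : F.map a ≫ F.map b = 𝟙 _ := by rw [← F.map_comp, hab, F.map_id]
      simp [hf, reassoc_of% hab', hab']
    obtain ⟨fY, lY⟩ := finrank_end_lt_of_retract k i p hip (by rw [hpi]; exact he1)
    obtain ⟨fZ, lZ⟩ := finrank_end_lt_of_retract k i' p' hip' (by
      rw [hpi']
      intro h
      exact he0 (sub_eq_self.1 h))
    obtain ⟨dY⟩ := ih _ (hn ▸ lY) Y (surj i p hip) rfl
    obtain ⟨dZ⟩ := ih _ (hn ▸ lZ) Z (surj i' p' hip') rfl
    exact ⟨.sum (F.map i) (F.map p) (F.map i') (F.map p')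
      (by rw [← F.map_comp, hip, F.map_id]) (by rw [← F.map_comp, hip', F.map_id])
      (by rw [← F.map_comp, h₃, F.map_zero]) (by rw [← F.map_comp, h₄, F.map_zero])
      (by rw [← F.map_comp, ← F.map_comp, ← F.map_add, hsum, F.map_id]) dY dZ⟩

end

end CategoryTheory

/-! ### Projective models and bounded representatives -/

namespace DerivedCategory

open Pretriangulated Triangulated TStructure

variable {C : Type u} [Category.{v} C] [Abelian C] [HasDerivedCategory.{w} C]

/-- Morphisms in the derived category from a K-projective complex lift to morphisms of
complexes. -/
theorem Q_map_surjective_of_isKProjective (K L : CochainComplex C ℤ) [K.IsKProjective] :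
    Function.Surjective (Q.map : (K ⟶ L) → (Q.obj K ⟶ Q.obj L)) := fun f ↦ by
  obtain ⟨g, hg⟩ := (CochainComplex.IsKProjective.Qh_map_bijective K
    ((HomotopyCategory.quotient _ _).obj L)).surjective
      ((quotientCompQhIso C).hom.app K ≫ f ≫ (quotientCompQhIso C).inv.app L)
  obtain ⟨g, rfl⟩ := (HomotopyCategory.quotient C (.up ℤ)).map_surjective g
  refine ⟨g, ?_⟩
  rw [← cancel_epi ((quotientCompQhIso C).hom.app K), ← quotientCompQhIso_hom_naturality, hg]
  simp

/-- The property of being isomorphic to a bounded above complex of projective objects. -/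
def hasProjectiveModel : ObjectProperty (DerivedCategory C) := fun X ↦
  ∃ (P : CochainComplex C ℤ) (n : ℤ), P.IsStrictlyLE n ∧ (∀ i, Projective (P.X i)) ∧
    Nonempty (Q.obj P ≅ X)

theorem hasProjectiveModel_of_iso {X Y : DerivedCategory C} (e : X ≅ Y)
    (h : hasProjectiveModel X) : hasProjectiveModel Y := by
  obtain ⟨P, n, hn, hP, ⟨e'⟩⟩ := h
  exact ⟨P, n, hn, hP, ⟨e' ≪≫ e⟩⟩

theorem hasProjectiveModel_shift {X : DerivedCategory C} (h : hasProjectiveModel X) (a : ℤ) :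
    hasProjectiveModel (X⟦a⟧) := by
  obtain ⟨P, n, hn, hP, ⟨e⟩⟩ := h
  exact ⟨P⟦a⟧, n - a, P.isStrictlyLE_shift n a (n - a) (by lia), fun i ↦ hP _,
    ⟨(Q.commShiftIso a).app P ≪≫ (shiftFunctor _ a).mapIso e⟩⟩

/-- The first map lifts to a chain map between the models, and its mapping cone is again bounded
above with projective terms. -/
theorem hasProjectiveModel_obj₃ (T : Triangle (DerivedCategory C)) (hT : T ∈ distTriang _)
    (h₁ : hasProjectiveModel T.obj₁) (h₂ : hasProjectiveModel T.obj₂) :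
    hasProjectiveModel T.obj₃ := by
  obtain ⟨P₁, n₁, hn₁, hP₁, ⟨e₁⟩⟩ := h₁
  obtain ⟨P₂, n₂, hn₂, hP₂, ⟨e₂⟩⟩ := h₂
  have := CochainComplex.isKProjective_of_projective P₁ n₁
  obtain ⟨f, hf⟩ := Q_map_surjective_of_isKProjective P₁ P₂ (e₁.hom ≫ T.mor₁ ≫ e₂.inv)
  refine ⟨CochainComplex.mappingCone f, max n₁ n₂, ?_, fun i ↦ ?_,
    ⟨Triangle.π₃.mapIso (isoTriangleOfIso₁₂ _ T (mappingCone_triangle_distinguished f) hT e₁ e₂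
      (by
        change Q.map f ≫ e₂.hom = e₁.hom ≫ T.mor₁
        simp [hf]))⟩⟩
  · rw [CochainComplex.isStrictlyLE_iff]
    intro i hi
    rw [CochainComplex.mappingCone.isZero_X_iff]
    exact ⟨P₁.isZero_of_isStrictlyLE n₁ _ (by lia), P₂.isZero_of_isStrictlyLE n₂ _ (by lia)⟩
  · exact Projective.of_iso (HomologicalComplex.homotopyCofiber.XIsoBiprod f i (i + 1) rfl).symm
      inferInstance

theorem hasProjectiveModel_obj₂ (T : Triangle (DerivedCategory C)) (hT : T ∈ distTriang _)
    (h₁ : hasProjectiveModel T.obj₁) (h₃ : hasProjectiveModel T.obj₃) :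
    hasProjectiveModel T.obj₂ :=
  hasProjectiveModel_obj₃ _ (inv_rot_of_distTriang _ hT) (hasProjectiveModel_shift h₃ (-1)) h₁

/-- A retract of a bounded object is bounded. -/
theorem bounded_of_retract {X Y : DerivedCategory C} (r : Retract Y X) (hX : t.bounded X) :
    t.bounded Y := by
  have hz (i : ℤ) (h : IsZero ((homologyFunctor C i).obj X)) :
      IsZero ((homologyFunctor C i).obj Y) := by
    rw [IsZero.iff_id_eq_zero, ← (r.map (homologyFunctor C i)).retract]
    exact (congrArg (· ≫ _) (h.eq_of_tgt _ 0)).trans zero_comp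
  obtain ⟨⟨a, ha⟩, ⟨b, hb⟩⟩ := hX
  exact ⟨⟨a, (isGE_iff _ _).2 fun i hi ↦ hz i ((isGE_iff _ _).1 ha i hi)⟩,
    ⟨b, (isLE_iff _ _).2 fun i hi ↦ hz i ((isLE_iff _ _).1 hb i hi)⟩⟩

variable [EnoughProjectives C]

theorem hasProjectiveModel_singleFunctor (M : C) (n : ℤ) :
    hasProjectiveModel ((singleFunctor C n).obj M) := by
  have h₀ : hasProjectiveModel ((singleFunctor C 0).obj M) :=
    let R := ProjectiveResolution.of M
    ⟨R.cochainComplex, 0, inferInstance, inferInstance,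
      ⟨asIso (Q.map R.π') ≪≫ ((singleFunctorIsoCompQ C 0).app M).symm⟩⟩
  exact hasProjectiveModel_of_iso (((singleFunctors C).shiftIso (-n) n 0 (by lia)).app M)
    (hasProjectiveModel_shift h₀ (-n))

/-- Dévissage on the cohomological amplitude: the truncation triangle peels off the top cohomology,
a shifted single object. -/
theorem hasProjectiveModel_of_isGE_of_isLE (X : DerivedCategory C) (a : ℤ) (n : ℕ) [X.IsGE a]
    [X.IsLE (a + n)] : hasProjectiveModel X := by
  induction n generalizing X with
  | zero =>
    have : X.IsLE a := by simpa using ‹X.IsLE (a + (0 : ℕ))›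
    obtain ⟨M, ⟨e⟩⟩ := exists_iso_singleFunctor_obj_of_isGE_of_isLE X a
    exact hasProjectiveModel_of_iso e.symm (hasProjectiveModel_singleFunctor M a)
  | succ n ih =>
    have h₁ : hasProjectiveModel ((t.truncLT (a + (n + 1 : ℕ))).obj X) :=
      have := t.isLE_truncLT_obj X (a + (n + 1 : ℕ)) (a + n)
      ih _
    have h₃ : hasProjectiveModel ((t.truncGE (a + (n + 1 : ℕ))).obj X) := by
      obtain ⟨M, ⟨e⟩⟩ := exists_iso_singleFunctor_obj_of_isGE_of_isLE
        ((t.truncGE (a + (n + 1 : ℕ))).obj X) (a + (n + 1 : ℕ))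
      exact hasProjectiveModel_of_iso e.symm (hasProjectiveModel_singleFunctor M _)
    exact hasProjectiveModel_obj₂ _ (t.triangleLTGE_distinguished (a + (n + 1 : ℕ)) X) h₁ h₃

/-- An object of the bounded derived category is represented by a bounded complex all of whose
endomorphisms in the derived category are induced by endomorphisms of the complex. -/
theorem exists_iso_Q_obj_map_surjective (X : DerivedCategory C) (hX : t.bounded X) :
    ∃ (K : CochainComplex C ℤ) (a b : ℤ), K.IsStrictlyGE a ∧ K.IsStrictlyLE b ∧
      Nonempty (Q.obj K ≅ X) ∧ Function.Surjective (Q.map : (K ⟶ K) → _) := by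
  obtain ⟨⟨a, ha⟩, ⟨b, hb⟩⟩ := hX
  -- If `b < a`, the natural number is `0` and the upper bound merely weakens to `a`.
  have : X.IsLE (a + (b - a).toNat) := t.isLE_of_le _ b _ (by lia)
  obtain ⟨P, n, hn, hP, ⟨e⟩⟩ := hasProjectiveModel_of_isGE_of_isLE X a (b - a).toNat
  have := CochainComplex.isKProjective_of_projective P n
  have : P.IsGE a := by
    rw [← isGE_Q_obj_iff]
    exact t.isGE_of_iso e.symm a
  -- The truncation need not be K-projective, but endomorphisms lift to `P` and descend by
  -- naturality of the quasi-isomorphism `P.πTruncGE a`.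
  refine ⟨P.truncGE a, a, n, inferInstance, inferInstance,
    ⟨(asIso (Q.map (P.πTruncGE a))).symm ≪≫ e⟩, fun g ↦ ?_⟩
  obtain ⟨f, hf⟩ := Q_map_surjective_of_isKProjective P P
    (Q.map (P.πTruncGE a) ≫ g ≫ inv (Q.map (P.πTruncGE a)))
  refine ⟨CochainComplex.truncGEMap f a, ?_⟩
  rw [← cancel_epi (Q.map (P.πTruncGE a)), ← Q.map_comp, CochainComplex.πTruncGE_naturality,
    Q.map_comp, hf]
  simp

end DerivedCategory

/-! ### Finiteness of Hom spaces and enough projectives -/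

/-- Morphisms from a strictly bounded cochain complex `K` to `L` form a finite-dimensional space if
the morphisms do so in each degree. -/
theorem CochainComplex.finiteDimensional_hom (k : Type*) [Field k] {C : Type u} [Category.{v} C]
    [Preadditive C] [HasZeroObject C] [Linear k C]
    (K L : CochainComplex C ℤ) (a b : ℤ) [K.IsStrictlyGE a] [K.IsStrictlyLE b]
    (h : ∀ i, FiniteDimensional k (K.X i ⟶ L.X i)) : FiniteDimensional k (K ⟶ L) := by
  let φ : (K ⟶ L) →ₗ[k] (∀ i : Set.Icc a b, K.X i ⟶ L.X i) :=
    { toFun := fun f i ↦ f.f i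
      map_add' := fun _ _ ↦ rfl
      map_smul' := fun _ _ ↦ rfl }
  refine Module.Finite.of_injective φ fun f g hfg ↦ ?_
  ext i
  by_cases hi : a ≤ i ∧ i ≤ b
  · exact congrFun hfg ⟨i, hi⟩
  · rcases not_and_or.1 hi with hi | hi
    · exact (K.isZero_of_isStrictlyGE a i (by lia)).eq_of_src _ _
    · exact (K.isZero_of_isStrictlyLE b i (by lia)).eq_of_src _ _

namespace FGModuleCat

/-- Finitely generated modules over a noetherian ring form a category with enough projectives. -/
theorem enoughProjectives (A : Type u) [Ring A] [IsNoetherianRing A] :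
    EnoughProjectives (FGModuleCat.{u} A) where
  presentation M := by
    obtain ⟨n, f, hf⟩ := Module.Finite.exists_fin' A M
    let e : FGModuleCat.of A (Fin n → A) ⟶ M := ObjectProperty.homMk (ModuleCat.ofHom f)
    have he : Epi e := (ModuleCat.isFG A).ι.epi_of_epi_map ((ModuleCat.epi_iff_surjective _).2 hf)
    have hP : Projective (FGModuleCat.of A (Fin n → A)) := ⟨fun {E X} g q hq ↦ by
      have hq' : Function.Surjective q.hom.hom :=
        (ModuleCat.epi_iff_surjective _).1
          (inferInstanceAs (Epi ((forget₂ (FGModuleCat A) (ModuleCat A)).map q)))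
      obtain ⟨s, hs⟩ := Module.projective_lifting_property q.hom.hom g.hom.hom hq'
      exact ⟨ObjectProperty.homMk (ModuleCat.ofHom s), FGModuleCat.hom_ext hs⟩⟩
    exact ⟨{ p := _, projective := hP, f := e, epi := he }⟩

/-- The Hom spaces between finitely generated modules over a finite-dimensional algebra are
finite-dimensional. -/
theorem finiteDimensional_hom (k : Type v) [Field k] (A : Type u) [Ring A] [Algebra k A]
    [FiniteDimensional k A] (M N : FGModuleCat.{u} A) : FiniteDimensional k (M ⟶ N) := by
  let _ : Module k M := Module.compHom M (algebraMap k A)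
  let _ : Module k N := Module.compHom N (algebraMap k A)
  have : IsScalarTower k A M := ⟨fun r a m ↦ by rw [Algebra.smul_def, mul_smul]; rfl⟩
  have : IsScalarTower k A N := ⟨fun r a m ↦ by rw [Algebra.smul_def, mul_smul]; rfl⟩
  have : FiniteDimensional k M := (finite_iff_finiteDimensional k A M).1 inferInstance
  have : FiniteDimensional k N := (finite_iff_finiteDimensional k A N).1 inferInstance
  let φ : (M ⟶ N) →ₗ[k] (M →ₗ[k] N) :=
    { toFun := fun f ↦ f.hom.hom.restrictScalars k
      map_add' := fun _ _ ↦ rfl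
      map_smul' := fun _ _ ↦ rfl }
  refine Module.Finite.of_injective φ fun f g hfg ↦ ?_
  ext x
  exact LinearMap.congr_fun hfg x

end FGModuleCat

theorem theoremB2 (k : Type v) [Field k] (A : Type u) [Ring A] [Algebra k A]
    [FiniteDimensional k A] :
    haveI : IsNoetherianRing A := IsNoetherianRing.of_finite k A
    ∀ [HasDerivedCategory.{w} (FGModuleCat.{u} A)],
      IsKrullSchmidt (DerivedCategory.Bounded (FGModuleCat.{u} A)) := by
  have : IsNoetherianRing A := IsNoetherianRing.of_finite k A
  intro _
  have := FGModuleCat.enoughProjectives A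
  refine ⟨fun X ↦ ?_⟩
  obtain ⟨K, a, b, _, _, ⟨e⟩, hK⟩ :=
    DerivedCategory.exists_iso_Q_obj_map_surjective X.obj X.property
  have := CochainComplex.finiteDimensional_hom k K K a b
    fun i ↦ FGModuleCat.finiteDimensional_hom k A _ _
  obtain ⟨d⟩ := nonempty_localDecomposition_map k DerivedCategory.Q K hK
  let d' := d.ofIso e
  -- The summands arise in the unbounded derived category; being retracts of a bounded object, they
  -- are bounded.
  obtain ⟨n, Y, hY, hloc⟩ := (d'.lift _ X fun j ↦
    DerivedCategory.bounded_of_retract (d'.retract j) X.property).exists_iso_biproduct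
  have := hasBinaryBiproducts_of_finite_biproducts (DerivedCategory.Bounded (FGModuleCat.{u} A))
  exact ⟨n, Y, hY, fun i ↦ ⟨have := hloc i; indecomposable_of_isLocalRing_end _, hloc i⟩⟩
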